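/- **Conventions.** Let $e_1,\dots,e_n$ be the standard basis of $\mathbb Z^n$. For a finite set $A\subset\mathbb Z^n$ and $B\subseteq A$ let $r(B)=\dim\operatorname{span}B$ and let $m(B)$ be the index of $\mathbb ZB$ in $\operatorname{span}(B)\cap\mathbb Z^n$. The arithmetic Tutte polynomial and the arithmetic coboundary polynomial of $A$ in the lattice $\mathbb Z^n$ are $$M_A(x,y)=\sum_{B\subseteq A}m(B)(x-1)^{r(A)-r(B)}(y-1)^{|B|-r(B)},\qquad \psi_A(X,Y)=(y-1)^{r(A)}M_A(x,y),\quad x=\tfrac{X+Y-1}{Y-1},\ y=Y .$$ Consider the positive roots of the classical root systems $$A_{n-1}=\{e_i-e_j: i<j\},\qquad D_n=\{e_i-e_j,\ e_i+e_j: i<j\},\qquad B_n=D_n\cup\{e_i: 1\le i\le n\},\qquad C_n=D_n\cup\{2e_i: 1\le i\le n\}$$ (where $1\le i<j\le n$), all as subsets of $\mathbb Z^n$, and put $$\Psi_A=1+X\sum_{n\ge1}\psi_{A_{n-1}}(X,Y)\frac{Z^n}{n!},\qquad \Psi_\Phi=\sum_{n\ge0}\psi_{\Phi_n}(X,Y)\frac{Z^n}{n!}\quad(\Phi=B,C,D).$$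 Let $F(\alpha,\beta)=\sum_{n\ge0}\alpha^n\beta^{\binom n2}/n!$. For a formal power series $f$ in $Z$ with constant term $1$ and an exponent $a\in\mathbb Q(X,Y)$, let $f^a=\sum_{k\ge0}\binom ak(f-1)^k$. **Theorem 1.8.** As formal power series in $Z$ with coefficients in $\mathbb Q(X,Y)$, $$\Psi_A=F(Z,Y)^X,$$ $$\Psi_B=F(2Z,Y)^{\frac X2-1}\,F(Z,Y^2)\,F(YZ,Y^2),$$ $$\Psi_C=F(2Z,Y)^{\frac X2-1}\,F(YZ,Y^2)^2,$$ $$\Psi_D+(X-1)Z=F(2Z,Y)^{\frac X2-1}\,F(Z,Y^2)^2 .$$ The term $(X-1)Z$ affects only the coefficient $n=1$: the configuration $D_1$ is empty, of rank $0$ in $\mathbb Z^1$, so $\psi_{D_1}=1$, while the right-hand side has the coefficient $X=X^{1-r(D_1)}\psi_{D_1}$. For every $n\ne1$ the coefficient of $Z^n/n!$ in $F(2Z,Y)^{\frac X2-1}F(Z,Y^2)^2$ is $\psi_{D_n}(X,Y)$. -/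

import Mathlib

namespace ArithTutte

noncomputable section

/-! ### Arithmetic Tutte and coboundary polynomials of a vector configuration in `ℤⁿ` -/

/-- The inclusion of the integer lattice `ℤⁿ` in the vector space `ℚⁿ`. -/
def latticeIncl (n : ℕ) : (Fin n → ℤ) →+ (Fin n → ℚ) :=
  (Int.castAddHom ℚ).compLeft (Fin n)

/-- The linear span of a configuration of lattice vectors. -/
def linSpan {n : ℕ} (B : Finset (Fin n → ℤ)) : Submodule ℚ (Fin n → ℚ) :=
  Submodule.span ℚ (latticeIncl n '' (B : Set (Fin n → ℤ)))

/-- The rank `r(B) = dim span B`. -/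
def rank {n : ℕ} (B : Finset (Fin n → ℤ)) : ℕ :=
  Module.finrank ℚ (linSpan B)

/-- The lattice `span B ∩ ℤⁿ`, as a subgroup of `ℤⁿ`. -/
def spanLattice {n : ℕ} (B : Finset (Fin n → ℤ)) : AddSubgroup (Fin n → ℤ) :=
  (linSpan B).toAddSubgroup.comap (latticeIncl n)

/-- The multiplicity `m(B)`: the index of `ℤB` as a sublattice of `span B ∩ ℤⁿ`. -/
def multiplicity {n : ℕ} (B : Finset (Fin n → ℤ)) : ℕ :=
  (AddSubgroup.closure (B : Set (Fin n → ℤ))).relIndex (spanLattice B)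

/-- The arithmetic Tutte polynomial
`M_A(x,y) = ∑_{B ⊆ A} m(B) (x-1)^{r(A)-r(B)} (y-1)^{|B|-r(B)}` in `ℤ[x,y]`, where `x` and `y` are
the variables `0` and `1`. Both natural number subtractions are exact. -/
def arithTutte {n : ℕ} (A : Finset (Fin n → ℤ)) : MvPolynomial (Fin 2) ℤ :=
  ∑ B ∈ A.powerset, (multiplicity B : MvPolynomial (Fin 2) ℤ)
    * (MvPolynomial.X 0 - 1) ^ (rank A - rank B)
    * (MvPolynomial.X 1 - 1) ^ (B.card - rank B)

/-- The field `ℚ(X,Y)` of rational functions in two variables. -/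
abbrev K : Type := FractionRing (MvPolynomial (Fin 2) ℚ)

/-- The variable `X` in `ℚ(X,Y)`. -/
def vX : K := algebraMap (MvPolynomial (Fin 2) ℚ) K (MvPolynomial.X 0)

/-- The variable `Y` in `ℚ(X,Y)`. -/
def vY : K := algebraMap (MvPolynomial (Fin 2) ℚ) K (MvPolynomial.X 1)

/-- The arithmetic coboundary polynomial
`ψ_A(X,Y) = (y-1)^{r(A)} M_A(x,y)` with `x = (X+Y-1)/(Y-1)` and `y = Y`. -/
def coboundary {n : ℕ} (A : Finset (Fin n → ℤ)) : K :=
  (vY - 1) ^ rank A * MvPolynomial.aeval ![(vX + vY - 1) / (vY - 1), vY] (arithTutte A)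

/-! ### The positive roots of the classical root systems, as vectors of `ℤⁿ` -/

/-- The standard basis vector `e_i` of `ℤⁿ`. -/
def e {n : ℕ} (i : Fin n) : Fin n → ℤ := Pi.single i 1

/-- The pairs `(i,j)` with `i < j`. -/
def pairs (n : ℕ) : Finset (Fin n × Fin n) :=
  Finset.univ.filter fun p => p.1 < p.2

/-- `A_{n-1} = {e_i - e_j : i < j}` in `ℤⁿ` (indexed by the dimension `n` of the lattice). -/
def rootsA (n : ℕ) : Finset (Fin n → ℤ) :=
  (pairs n).image fun p => e p.1 - e p.2

/-- `D_n = {e_i - e_j, e_i + e_j : i < j}`. -/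
def rootsD (n : ℕ) : Finset (Fin n → ℤ) :=
  ((pairs n).image fun p => e p.1 - e p.2) ∪ ((pairs n).image fun p => e p.1 + e p.2)

/-- `B_n = {e_i - e_j, e_i + e_j : i < j} ∪ {e_i}`. -/
def rootsB (n : ℕ) : Finset (Fin n → ℤ) :=
  ((pairs n).image fun p => e p.1 - e p.2) ∪ ((pairs n).image fun p => e p.1 + e p.2)
    ∪ (Finset.univ.image fun i => e i)

/-- `C_n = {e_i - e_j, e_i + e_j : i < j} ∪ {2 e_i}`. -/
def rootsC (n : ℕ) : Finset (Fin n → ℤ) :=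
  ((pairs n).image fun p => e p.1 - e p.2) ∪ ((pairs n).image fun p => e p.1 + e p.2)
    ∪ (Finset.univ.image fun i => 2 • e i)

/-! ### Generating functions: formal power series in `Z` over `ℚ(X,Y)` -/

/-- The variable `Z`. -/
def vZ : PowerSeries K := PowerSeries.X

/-- `Ψ_Φ = ∑_{n ≥ 0} ψ_{Φ_n}(X,Y) Zⁿ/n!`, for a family `Φ_n` of configurations in `ℤⁿ`. -/
def Psi (Φ : (n : ℕ) → Finset (Fin n → ℤ)) : PowerSeries K :=
  PowerSeries.mk fun n => coboundary (Φ n) / (n.factorial : K)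

/-- `Ψ_A = 1 + X ∑_{n ≥ 1} ψ_{A_{n-1}}(X,Y) Zⁿ/n!`. -/
def PsiA : PowerSeries K :=
  1 + PowerSeries.C vX *
    PowerSeries.mk fun n => if n = 0 then 0 else coboundary (rootsA n) / (n.factorial : K)

/-- The deformed exponential function `F(α,β) = ∑_{n ≥ 0} αⁿ β^{C(n,2)} / n!`, for a power series
`α` in `Z` with zero constant term and a coefficient `β`. -/
def F (α : PowerSeries K) (β : K) : PowerSeries K :=
  (PowerSeries.mk fun n => β ^ n.choose 2 / (n.factorial : K)).subst α

/-- The power `f ^ a = ∑_k C(a,k) (f - 1)^k` of a formal power series `f` with constant term `1`,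
for an arbitrary exponent `a` in `ℚ(X,Y)`. -/
def cpow (f : PowerSeries K) (a : K) : PowerSeries K :=
  (PowerSeries.binomialSeries K a).subst (f - 1)

end

end ArithTutte

namespace ArithTutte

noncomputable section

/-! The proof is the finite field method over `ℤ/N`. Smith normal form of `ℤB` shows that `B`
annihilates exactly `N^(n - r(B)) m(B)` points of `(ℤ/N)ⁿ` whenever `m(B) ∣ N` (`card_annihilator`).
Expanding `Y = (Y - 1) + 1` over the members of `A` then identifies `X^(n - r(A)) ψ_A` at `X = N`
with the sum over points of `Y` to the number of members of `A` vanishing there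
(`eval_charSum_natCast`). Each coefficient of the right-hand sides is also a polynomial in `X`, so
it suffices to compare at infinitely many `N = 2M` (`charSum_eq_of_count`).

The count is a product of exponential generating functions (`sum_weights`). In type `A` each residue
contributes a factor `F(Z,Y)`. In the other types coordinates are grouped up to sign. Each of the `M
- 1` classes `{x, -x}` with `x ≠ -x` contributes `F(2Z,Y)`, since exactly one of `e_i ± e_j`
vanishes on two coordinates of the class. On the classes `{0}` and `{M}` both vanish, giving `Y²`.
The roots `e_i` vanish only at `0` and `2e_i` at both `0` and `M`, which turns `Z` into `YZ` there
(`sum_signed_weights`). -/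

theorem latticeIncl_injective (n : ℕ) : Function.Injective (latticeIncl n) := by
  intro x y h
  funext i
  have := congrFun h i
  simpa [latticeIncl] using this

theorem latticeIncl_zsmul {n : ℕ} (c : ℤ) (x : Fin n → ℤ) :
    latticeIncl n (c • x) = (c : ℚ) • latticeIncl n x := by
  rw [map_zsmul, Int.cast_smul_eq_zsmul]

theorem linearIndependent_latticeIncl {n : ℕ} {ι : Type*} {b : ι → Fin n → ℤ}
    (hb : LinearIndependent ℤ b) : LinearIndependent ℚ fun i => latticeIncl n (b i) := by
  rw [← LinearIndependent.iff_fractionRing (R := ℤ) (K := ℚ)]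
  exact hb.map' (latticeIncl n).toIntLinearMap
    (LinearMap.ker_eq_bot.2 (latticeIncl_injective n))

theorem latticeIncl_mem_linSpan {n : ℕ} {B : Finset (Fin n → ℤ)} {x : Fin n → ℤ}
    (hx : x ∈ Submodule.span ℤ (B : Set (Fin n → ℤ))) : latticeIncl n x ∈ linSpan B := by
  induction hx using Submodule.span_induction with
  | mem x h => exact Submodule.subset_span ⟨x, h, rfl⟩
  | zero => simp
  | add x y _ _ hx hy => rw [map_add]; exact add_mem hx hy
  | smul c x _ hx => rw [latticeIncl_zsmul]; exact Submodule.smul_mem _ _ hx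

/-! ### Rank and multiplicity from Smith normal form. -/

section Smith

variable {n k : ℕ} {B : Finset (Fin n → ℤ)}
  (s : Module.Basis.SmithNormalForm (Submodule.span ℤ (B : Set (Fin n → ℤ))) (Fin n) k)

include s

theorem smith_coeff_ne_zero (i : Fin k) : s.a i ≠ 0 := by
  intro h
  apply s.bN.ne_zero i
  apply Subtype.ext
  rw [s.snf, h, zero_smul]; rfl

theorem linSpan_eq_span_smith :
    linSpan B = Submodule.span ℚ (Set.range fun i => latticeIncl n (s.bM (s.f i))) := by
  apply le_antisymm
  · rw [linSpan, Submodule.span_le]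
    rintro _ ⟨b, hb, rfl⟩
    have hb' : b ∈ Submodule.span ℤ (B : Set (Fin n → ℤ)) := Submodule.subset_span hb
    have h := congrArg Subtype.val (s.bN.sum_repr ⟨b, hb'⟩)
    rw [AddSubmonoidClass.coe_finsetSum] at h
    have h' : b = ∑ i, (s.bN.repr ⟨b, hb'⟩ i * s.a i) • s.bM (s.f i) := by
      refine h.symm.trans (Finset.sum_congr rfl fun i _ => ?_)
      rw [Submodule.coe_smul, s.snf, mul_smul]
    rw [h', map_sum]
    refine Submodule.sum_mem _ fun i _ => ?_
    rw [latticeIncl_zsmul]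
    exact Submodule.smul_mem _ _ (Submodule.subset_span ⟨i, rfl⟩)
  · rw [Submodule.span_le]
    rintro _ ⟨i, rfl⟩
    have h := latticeIncl_mem_linSpan (s.bN i).2
    rw [s.snf, latticeIncl_zsmul] at h
    have h2 := Submodule.smul_mem _ ((s.a i : ℚ)⁻¹) h
    rwa [smul_smul, inv_mul_cancel₀ (Int.cast_ne_zero.2 (smith_coeff_ne_zero s i)), one_smul] at h2

theorem linearIndependent_smith : LinearIndependent ℤ fun i => s.bM (s.f i) :=
  s.bM.linearIndependent.comp _ s.f.injective

theorem rank_eq_smith : rank B = k := by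
  rw [rank, linSpan_eq_span_smith s,
    finrank_span_eq_card (linearIndependent_latticeIncl (linearIndependent_smith s)),
    Fintype.card_fin]

/-- Since `s.bM` stays independent over `ℚ`, the coordinates of a lattice point are unique; lying in
the rational span forces those outside the range of `s.f` to vanish. -/
theorem spanLattice_eq_smith :
    (spanLattice B).toIntSubmodule = Submodule.span ℤ (Set.range fun i => s.bM (s.f i)) := by
  apply le_antisymm
  · intro x hx
    have hx' : latticeIncl n x ∈ linSpan B := hx
    rw [linSpan_eq_span_smith s] at hx'
    have hli := linearIndependent_latticeIncl s.bM.linearIndependent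
    have hrange : (Set.range fun i => latticeIncl n (s.bM (s.f i)))
        = (fun j => latticeIncl n (s.bM j)) '' Set.range s.f := by
      rw [← Set.range_comp]; rfl
    have hrange' : (Set.range fun i => s.bM (s.f i)) = s.bM '' Set.range s.f := by
      rw [← Set.range_comp]; rfl
    rw [hrange] at hx'
    rw [hrange', Module.Basis.mem_span_image]
    intro j hj
    by_contra hjf
    have hsum : latticeIncl n x = ∑ j, (s.bM.repr x j : ℚ) • latticeIncl n (s.bM j) := by
      conv_lhs => rw [← s.bM.sum_repr x, map_sum]
      simp_rw [latticeIncl_zsmul]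
    obtain ⟨l, hl, hlx⟩ := (Finsupp.mem_span_image_iff_linearCombination ℚ).1 hx'
    have h1 : Finsupp.linearCombination ℚ (fun j => latticeIncl n (s.bM j))
        ((s.bM.repr x).mapRange (fun z : ℤ => (z : ℚ)) (by simp)) = latticeIncl n x := by
      rw [hsum, Finsupp.linearCombination_apply, Finsupp.sum_fintype _ _ (by simp)]
      simp
    have h2 := hli (hlx.trans h1.symm)
    have h3 := DFunLike.congr_fun h2 j
    have h4 : l j = 0 := by
      by_contra h
      exact hjf (hl (Finsupp.mem_support_iff.2 h))
    rw [h4, Finsupp.mapRange_apply] at h3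
    exact (Finsupp.mem_support_iff.1 hj) (by exact_mod_cast h3.symm)
  · rw [Submodule.span_le]
    rintro _ ⟨i, rfl⟩
    change latticeIncl n (s.bM (s.f i)) ∈ linSpan B
    rw [linSpan_eq_span_smith s]
    exact Submodule.subset_span ⟨i, rfl⟩

/-- In the adapted bases the inclusion of `ℤB` in its saturation is diagonal with entries `s.a`, and
the index is the absolute determinant. -/
theorem multiplicity_eq_smith : multiplicity B = ∏ i, (s.a i).natAbs := by
  have hle : AddSubgroup.closure (B : Set (Fin n → ℤ)) ≤ spanLattice B := by
    rw [AddSubgroup.closure_le]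
    intro b hb
    exact Submodule.subset_span ⟨b, hb, rfl⟩
  have hcl : (AddSubgroup.closure (B : Set (Fin n → ℤ))).toIntSubmodule
      = Submodule.span ℤ (B : Set (Fin n → ℤ)) := by
    rw [← Submodule.span_int_eq_addSubgroupClosure]; rfl
  let b₁ := s.bN.map (LinearEquiv.ofEq _ _ hcl.symm)
  let b₂ := (Module.Basis.span (linearIndependent_smith s)).map
    (LinearEquiv.ofEq _ _ (spanLattice_eq_smith s).symm)
  rw [multiplicity, AddSubgroup.relIndex_eq_natAbs_det _ _ hle b₁ b₂]
  have h : (fun i => (⟨b₁ i, hle (SetLike.coe_mem _)⟩ : (spanLattice B).toIntSubmodule))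
      = fun i => s.a i • b₂ i := by
    funext i
    apply Subtype.ext
    change ((s.bN i : Fin n → ℤ)) = s.a i • ((Module.Basis.span (linearIndependent_smith s) i :
      Submodule.span ℤ (Set.range fun i => s.bM (s.f i))) : Fin n → ℤ)
    rw [s.snf, Module.Basis.span_apply]
  erw [h]
  rw [AlternatingMap.map_smul_univ, Module.Basis.det_self, smul_eq_mul, mul_one]
  exact map_prod Int.natAbsHom _ _

end Smith

theorem exists_smith {n : ℕ} (B : Finset (Fin n → ℤ)) : ∃ k, Nonempty
    (Module.Basis.SmithNormalForm (Submodule.span ℤ (B : Set (Fin n → ℤ))) (Fin n) k) :=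
  let s := (Submodule.span ℤ (B : Set (Fin n → ℤ))).smithNormalForm (Pi.basisFun ℤ (Fin n))
  ⟨s.1, ⟨s.2⟩⟩

theorem multiplicity_pos {n : ℕ} (B : Finset (Fin n → ℤ)) : 0 < multiplicity B := by
  obtain ⟨k, ⟨s⟩⟩ := exists_smith B
  rw [multiplicity_eq_smith s]
  exact Finset.prod_pos fun i _ => Int.natAbs_pos.2 (smith_coeff_ne_zero s i)

/-! ### Counting annihilated points. -/

theorem card_zsmul_eq_zero {N : ℕ} [NeZero N] (c : ℤ) :
    (Finset.univ.filter fun x : ZMod N => c • x = 0).card = N.gcd c.natAbs := by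
  have h := IsAddCyclic.card_nsmulAddMonoidHom_ker (G := ZMod N) c.natAbs
  rw [Nat.card_zmod] at h
  rw [← h]
  refine (Nat.subtype_card _ fun x => ?_).symm
  rw [AddMonoidHom.mem_ker, nsmulAddMonoidHom_apply, Finset.mem_filter_univ]
  rcases Int.natAbs_eq c with hc | hc <;> rw [hc] <;> simp

/-- The points of `(ℤ/N)ⁿ` annihilated by a configuration, for `N` divisible by its
multiplicity. -/
theorem card_annihilator {n : ℕ} (B : Finset (Fin n → ℤ)) {N : ℕ} [NeZero N]
    (hN : multiplicity B ∣ N) :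
    (Finset.univ.filter fun p : Fin n → ZMod N => ∀ b ∈ B, ∑ i, b i • p i = 0).card
      = N ^ (n - rank B) * multiplicity B := by
  obtain ⟨k, ⟨s⟩⟩ := exists_smith B
  -- A point is a homomorphism `ℤⁿ → ℤ/N`; `E` records its values on the adapted basis, where the
  -- conditions decouple.
  let E : (Fin n → ZMod N) ≃ (Fin n → ZMod N) :=
    ((Pi.basisFun ℤ (Fin n)).constr ℤ).toEquiv.trans (s.bM.constr (M' := ZMod N) ℤ).symm.toEquiv
  have hE : ∀ p j, E p j = ∑ i, s.bM j i • p i := by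
    intro p j
    simp [E, Module.Basis.constr_apply_fintype]
  -- Directions outside the span get coefficient `0`, hence no condition and `N` solutions.
  let c : Fin n → ℤ := Function.extend s.f s.a 0
  have hc : ∀ i, c (s.f i) = s.a i := fun i => s.f.injective.extend_apply _ _ i
  have hc0 : ∀ j, j ∉ Set.range s.f → c j = 0 := fun j hj =>
    Function.extend_apply' _ _ _ (by simpa using hj)
  have key : ∀ p : Fin n → ZMod N, (∀ b ∈ B, ∑ i, b i • p i = 0) ↔ ∀ j, c j • E p j = 0 := by
    intro p
    let φ : (Fin n → ℤ) →ₗ[ℤ] ZMod N := (Pi.basisFun ℤ (Fin n)).constr ℤ p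
    have hφ : ∀ b, φ b = ∑ i, b i • p i := fun b => by
      simp [φ, Module.Basis.constr_apply_fintype]
    have hEφ : ∀ j, E p j = φ (s.bM j) := fun j => by rw [hE, hφ]
    have h1 : (∀ b ∈ B, ∑ i, b i • p i = 0)
        ↔ Submodule.span ℤ (B : Set (Fin n → ℤ)) ≤ LinearMap.ker φ := by
      rw [Submodule.span_le]
      simp only [← hφ]; rfl
    rw [h1]
    constructor
    · intro h j
      by_cases hj : j ∈ Set.range s.f
      · obtain ⟨i, rfl⟩ := hj
        rw [hc, hEφ, ← map_smul, ← s.snf]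
        exact h (s.bN i).2
      · rw [hc0 j hj, zero_smul]
    · intro h x hx
      have hs := congrArg Subtype.val (s.bN.sum_repr ⟨x, hx⟩)
      rw [AddSubmonoidClass.coe_finsetSum] at hs
      rw [LinearMap.mem_ker]
      change φ ((⟨x, hx⟩ : Submodule.span ℤ (B : Set (Fin n → ℤ))) : Fin n → ℤ) = 0
      rw [← hs, map_sum]
      refine Finset.sum_eq_zero fun i _ => ?_
      rw [Submodule.coe_smul, map_smul, s.snf, map_smul, ← hEφ, ← hc, h, smul_zero]
  have hcard : (Finset.univ.filter fun p : Fin n → ZMod N => ∀ b ∈ B, ∑ i, b i • p i = 0).card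
      = (Fintype.piFinset fun j => Finset.univ.filter fun x : ZMod N => c j • x = 0).card := by
    refine Finset.card_equiv E fun p => ?_
    rw [Finset.mem_filter_univ, key, Fintype.mem_piFinset]
    simp only [Finset.mem_filter_univ]
  rw [hcard, Fintype.card_piFinset]
  simp_rw [card_zsmul_eq_zero]
  rw [← Finset.prod_mul_prod_compl (Finset.univ.map s.f), Finset.prod_map, multiplicity_eq_smith s,
    rank_eq_smith s, mul_comm]
  rw [multiplicity_eq_smith s] at hN
  congr 1
  · rw [Finset.prod_congr rfl (g := fun _ => N), Finset.prod_const, Finset.card_compl]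
    · simp
    · intro j hj
      rw [hc0 j (by simpa using hj)]; simp
  · refine Finset.prod_congr rfl fun i _ => ?_
    rw [hc]
    exact Nat.gcd_eq_right ((Finset.dvd_prod_of_mem _ (Finset.mem_univ i)).trans hN)

theorem rank_le {n : ℕ} (B : Finset (Fin n → ℤ)) : rank B ≤ n :=
  (Submodule.finrank_le (linSpan B)).trans (by simp)

theorem rank_mono {n : ℕ} {A B : Finset (Fin n → ℤ)} (h : B ⊆ A) : rank B ≤ rank A :=
  Submodule.finrank_mono (Submodule.span_mono (Set.image_mono h))

theorem rank_le_card {n : ℕ} (B : Finset (Fin n → ℤ)) : rank B ≤ B.card := by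
  classical
  have h := finrank_span_finset_le_card (R := ℚ) (B.image (latticeIncl n))
  rw [Finset.coe_image] at h
  exact h.trans Finset.card_image_le

/-! ### Exponential generating functions. -/

/-- The number of indices at which `q` takes the value `t`. -/
def fibreCard {n : ℕ} {T : Type*} [DecidableEq T] (q : Fin n → T) (t : T) : ℕ :=
  (Finset.univ.filter fun i => q i = t).card

/-- The compositional formula for products of exponential generating functions. -/
theorem sum_prod_fibreCard {R T : Type*} [Field R] [CharZero R] [Fintype T] [DecidableEq T]
    (w : T → ℕ → R) (n : ℕ) :
    (∑ q : Fin n → T, ∏ t, w t (fibreCard q t)) / (n.factorial : R)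
      = PowerSeries.coeff n (∏ t, PowerSeries.mk fun k => w t k / (k.factorial : R)) := by
  -- `L` replaces each monomial by its weight, so the identity is the image under `L` of the
  -- multinomial theorem for the `n`-th power of the sum of the variables.
  let L : MvPolynomial T R →ₗ[R] R :=
    (MvPolynomial.basisMonomials T R).constr R fun m => ∏ t, w t (m t)
  have hL : ∀ m : T →₀ ℕ, L (MvPolynomial.monomial m 1) = ∏ t, w t (m t) := fun m => by
    have := (MvPolynomial.basisMonomials T R).constr_basis R (fun m => ∏ t, w t (m t)) m
    rwa [MvPolynomial.coe_basisMonomials] at this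
  have hX : ∀ k : T → ℕ, (∏ t, (MvPolynomial.X t : MvPolynomial T R) ^ k t)
      = MvPolynomial.monomial (Finsupp.equivFunOnFinite.symm k) 1 := fun k => by
    rw [MvPolynomial.monomial_eq, Finsupp.prod_fintype _ _ (by simp)]
    simp
  have h1 : (∑ t, (MvPolynomial.X t : MvPolynomial T R)) ^ n
      = ∑ q : Fin n → T, MvPolynomial.monomial (Finsupp.equivFunOnFinite.symm (fibreCard q)) 1 := by
    rw [← Fin.prod_const, Finset.prod_univ_sum, Fintype.piFinset_univ]
    refine Finset.sum_congr rfl fun q _ => ?_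
    rw [← hX, ← Finset.prod_fiberwise' _ q]
    simp [fibreCard]
  have h2 := Finset.sum_pow_eq_sum_piAntidiag Finset.univ
    (fun t => (MvPolynomial.X t : MvPolynomial T R)) n
  rw [h1] at h2
  simp_rw [hX, ← nsmul_eq_mul] at h2
  have h3 := congrArg L h2
  rw [map_sum, map_sum] at h3
  simp_rw [map_nsmul, hL, Finsupp.equivFunOnFinite_symm_apply_apply] at h3
  rw [h3, PowerSeries.coeff_prod, Finset.sum_div]
  refine Finset.sum_equiv Finsupp.equivFunOnFinite.symm (fun k => ?_) fun k hk => ?_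
  · simp
  · have hs : ∑ t, k t = n := (Finset.mem_piAntidiag.1 hk).1
    have hm := Nat.multinomial_spec Finset.univ k
    rw [hs] at hm
    have hm' : (∏ t, ((k t).factorial : R)) * (Nat.multinomial Finset.univ k : R)
        = (n.factorial : R) := by exact_mod_cast hm
    have hp : (∏ t, ((k t).factorial : R)) ≠ 0 :=
      Finset.prod_ne_zero_iff.2 fun t _ => Nat.cast_ne_zero.2 (Nat.factorial_ne_zero _)
    simp only [PowerSeries.coeff_mk, Finsupp.equivFunOnFinite_symm_apply_apply, Finset.prod_div_distrib]
    rw [nsmul_eq_mul, div_eq_div_iff (Nat.cast_ne_zero.2 (Nat.factorial_ne_zero _)) hp, ← hm']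
    ring

theorem card_pairs_filter {n : ℕ} (s : Finset (Fin n)) :
    ((pairs n).filter fun p => p.1 ∈ s ∧ p.2 ∈ s).card = s.card.choose 2 := by
  have h1 : s.offDiag = ((pairs n).filter fun p => p.1 ∈ s ∧ p.2 ∈ s)
      ∪ (((pairs n).filter fun p => p.1 ∈ s ∧ p.2 ∈ s).map (Equiv.prodComm _ _).toEmbedding) := by
    ext ⟨i, j⟩
    simp only [pairs, Finset.mem_offDiag, Finset.mem_union, Finset.mem_filter, Finset.mem_univ,
      Finset.mem_map_equiv, Equiv.prodComm_symm, Equiv.prodComm_apply, Prod.swap]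
    have := lt_trichotomy i j
    grind
  have h2 : Disjoint ((pairs n).filter fun p => p.1 ∈ s ∧ p.2 ∈ s)
      (((pairs n).filter fun p => p.1 ∈ s ∧ p.2 ∈ s).map (Equiv.prodComm _ _).toEmbedding) := by
    rw [Finset.disjoint_left]
    rintro ⟨i, j⟩ h h'
    simp only [pairs, Finset.mem_filter, Finset.mem_univ,
      Finset.mem_map_equiv, Equiv.prodComm_symm, Equiv.prodComm_apply, Prod.swap] at h h'
    exact lt_asymm h.1.2 h'.1.2
  have h3 := congrArg Finset.card h1
  rw [Finset.card_union_of_disjoint h2, Finset.card_map, Finset.offDiag_card] at h3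
  rw [Nat.choose_two_right, Nat.mul_sub_one]
  omega

theorem prod_pairs_eq {R T : Type*} [CommMonoid R] [Fintype T] [DecidableEq T] {n : ℕ}
    (v : T → R) (q : Fin n → T) :
    (∏ p ∈ pairs n, if q p.1 = q p.2 then v (q p.1) else 1)
      = ∏ t, v t ^ (fibreCard q t).choose 2 := by
  rw [← Finset.prod_filter, ← Finset.prod_fiberwise' _ fun p : Fin n × Fin n => q p.1]
  refine Finset.prod_congr rfl fun t _ => ?_
  rw [Finset.prod_const, fibreCard, ← card_pairs_filter, Finset.filter_filter]
  congr 2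
  ext p
  simp only [Finset.mem_filter, Finset.mem_univ, true_and]
  grind

/-- The series `∑ uᵏ v^C(k,2) Zᵏ/k!`. -/
def deformedExp (u v : K) : PowerSeries K :=
  PowerSeries.mk fun k => u ^ k * v ^ k.choose 2 / (k.factorial : K)

theorem F_C_mul (u v : K) : F (PowerSeries.C u * vZ) v = deformedExp u v := by
  rw [F, vZ, ← PowerSeries.smul_eq_C_mul, ← PowerSeries.rescale_eq_subst]
  ext k
  simp [deformedExp, PowerSeries.coeff_rescale, mul_div_assoc]

theorem F_vZ (v : K) : F vZ v = deformedExp 1 v := by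
  rw [← F_C_mul, map_one, one_mul]

theorem F_two_mul (v : K) : F (2 * vZ) v = deformedExp 2 v := by
  rw [← F_C_mul, map_ofNat]

theorem constantCoeff_deformedExp (u v : K) :
    PowerSeries.constantCoeff (deformedExp u v) = 1 := by
  rw [← PowerSeries.coeff_zero_eq_constantCoeff_apply]
  simp [deformedExp]

theorem sum_weights {T : Type*} [Fintype T] [DecidableEq T] (u v : T → K) (n : ℕ) :
    (∑ q : Fin n → T, (∏ i, u (q i)) * ∏ p ∈ pairs n, if q p.1 = q p.2 then v (q p.1) else 1)
        / (n.factorial : K)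
      = PowerSeries.coeff n (∏ t, deformedExp (u t) (v t)) := by
  simp only [deformedExp]
  rw [← sum_prod_fibreCard fun t k => u t ^ k * v t ^ k.choose 2]
  congr 1
  refine Finset.sum_congr rfl fun q _ => ?_
  rw [prod_pairs_eq, Finset.prod_mul_distrib, ← Finset.prod_fiberwise' _ q]
  simp [fibreCard]

/-! ### The coboundary polynomial as a point count. -/

theorem vY_sub_one_ne_zero : vY - 1 ≠ 0 := by
  intro h
  have h1 : algebraMap (MvPolynomial (Fin 2) ℚ) K (MvPolynomial.X 1)
      = algebraMap (MvPolynomial (Fin 2) ℚ) K 1 := by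
    rw [map_one]; exact sub_eq_zero.1 h
  have h2 := IsFractionRing.injective (MvPolynomial (Fin 2) ℚ) K h1
  have h3 := congrArg (MvPolynomial.eval 0) h2
  simp at h3

/-- Because `x - 1 = X/(Y - 1)`, the powers of `Y - 1` that involve ranks cancel. -/
theorem coboundary_eq_sum {n : ℕ} (A : Finset (Fin n → ℤ)) :
    coboundary A = ∑ B ∈ A.powerset,
      (multiplicity B : K) * vX ^ (rank A - rank B) * (vY - 1) ^ B.card := by
  have hY := vY_sub_one_ne_zero
  rw [coboundary, arithTutte, map_sum, Finset.mul_sum]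
  refine Finset.sum_congr rfl fun B hB => ?_
  have h1 := rank_mono (Finset.mem_powerset.1 hB)
  have h2 := rank_le_card B
  obtain ⟨a, ha⟩ := Nat.exists_eq_add_of_le h1
  obtain ⟨b, hb⟩ := Nat.exists_eq_add_of_le h2
  have h3 : (vX + vY - 1) / (vY - 1) - 1 = vX / (vY - 1) := by
    field_simp; ring
  simp only [map_mul, map_pow, map_sub, map_natCast, map_one, MvPolynomial.aeval_X,
    Matrix.cons_val_zero, Matrix.cons_val_one]
  rw [h3, ha, hb, Nat.add_sub_cancel_left, Nat.add_sub_cancel_left, div_pow]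
  field_simp
  ring

/-- The coboundary polynomial scaled by `X ^ (n - r(A))`, with `X` specialised to `a`. -/
def charSum {n : ℕ} (A : Finset (Fin n → ℤ)) : Polynomial K :=
  ∑ B ∈ A.powerset,
    Polynomial.C ((multiplicity B : K) * (vY - 1) ^ B.card) * Polynomial.X ^ (n - rank B)

theorem eval_charSum_vX {n : ℕ} (A : Finset (Fin n → ℤ)) :
    (charSum A).eval vX = vX ^ (n - rank A) * coboundary A := by
  rw [coboundary_eq_sum, charSum, Polynomial.eval_finsetSum, Finset.mul_sum]
  refine Finset.sum_congr rfl fun B hB => ?_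
  have h1 := rank_mono (Finset.mem_powerset.1 hB)
  have h2 : n - rank B = (n - rank A) + (rank A - rank B) := by have := rank_le A; omega
  rw [h2]
  simp only [Polynomial.eval_mul, Polynomial.eval_C, Polynomial.eval_pow, Polynomial.eval_X]
  ring

/-- The finite field method: counting points of `(ℤ/N)ⁿ` by the number of members of the
configuration vanishing there. -/
theorem eval_charSum_natCast {n : ℕ} (A : Finset (Fin n → ℤ)) {N : ℕ} [NeZero N]
    (hN : ∀ B ⊆ A, multiplicity B ∣ N) :
    (charSum A).eval (N : K)
      = ∑ p : Fin n → ZMod N, ∏ a ∈ A, if ∑ i, a i • p i = 0 then vY else 1 := by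
  have h1 : ∀ p : Fin n → ZMod N, (∏ a ∈ A, if ∑ i, a i • p i = 0 then vY else 1)
      = ∑ B ∈ A.powerset, if ∀ b ∈ B, ∑ i, b i • p i = 0 then (vY - 1) ^ B.card else 0 := by
    intro p
    have h : ∀ a ∈ A, (if ∑ i, a i • p i = 0 then vY else 1)
        = (if ∑ i, a i • p i = 0 then vY - 1 else 0) + 1 := fun a _ => by split_ifs <;> simp
    rw [Finset.prod_congr rfl h, Finset.prod_add_one]
    refine Finset.sum_congr rfl fun B _ => ?_
    rw [Finset.prod_ite_zero, Finset.prod_const]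
  simp_rw [h1]
  rw [Finset.sum_comm, charSum, Polynomial.eval_finsetSum]
  refine Finset.sum_congr rfl fun B hB => ?_
  rw [← Finset.sum_filter, Finset.sum_const,
    card_annihilator B (hN B (Finset.mem_powerset.1 hB))]
  simp only [Polynomial.eval_mul, Polynomial.eval_C, Polynomial.eval_pow, Polynomial.eval_X,
    nsmul_eq_mul]
  push_cast
  ring

/-! ### Polynomiality in the exponent and interpolation. -/

theorem eval_descPochhammer_eq_factorial_mul_choose {R : Type*} [CommRing R] [BinomialRing R]
    (a : R) (k : ℕ) : (descPochhammer R k).eval a = (k.factorial : R) * Ring.choose a k := by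
  rw [← nsmul_eq_mul, ← Ring.descPochhammer_eq_factorial_smul_choose,
    ← descPochhammer_map (algebraMap ℤ R), Polynomial.eval_map_algebraMap,
    Polynomial.aeval_eq_smeval]

/-- As `Z^k` divides `(f - 1)^k`, only the terms `k ≤ n` matter, and each binomial coefficient is a
polynomial in the exponent. -/
theorem exists_polynomial_coeff_cpow {f : PowerSeries K} (hf : PowerSeries.constantCoeff f = 1)
    (n : ℕ) : ∃ P : Polynomial K, ∀ a, PowerSeries.coeff n (cpow f a) = P.eval a := by
  have hs : PowerSeries.HasSubst (f - 1) :=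
    PowerSeries.HasSubst.of_constantCoeff_zero' (by simp [hf])
  refine ⟨∑ k ∈ Finset.range (n + 1), Polynomial.C ((k.factorial : K)⁻¹ *
    PowerSeries.coeff n ((f - 1) ^ k)) * descPochhammer K k, fun a => ?_⟩
  rw [cpow, PowerSeries.coeff_subst' hs,
    finsum_eq_sum_of_support_subset (s := Finset.range (n + 1)), Polynomial.eval_finsetSum]
  · refine Finset.sum_congr rfl fun k _ => ?_
    have hk : (k.factorial : K) ≠ 0 := Nat.cast_ne_zero.2 (Nat.factorial_ne_zero k)
    have hd : (descPochhammer K k).eval a = (k.factorial : K) * Ring.choose a k :=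
      eval_descPochhammer_eq_factorial_mul_choose a k
    rw [PowerSeries.binomialSeries_coeff, Polynomial.eval_mul, Polynomial.eval_C, hd]
    simp only [smul_eq_mul, mul_one]
    field_simp
  · intro k hk
    rw [Finset.coe_range, Set.mem_Iio]
    by_contra hkn
    apply hk
    have : PowerSeries.coeff n ((f - 1) ^ k) = 0 := by
      have hX : PowerSeries.X ∣ f - 1 := PowerSeries.X_dvd_iff.2 (by simp [hf])
      exact PowerSeries.X_pow_dvd_iff.1 (pow_dvd_pow_of_dvd hX k) n (by omega)
    simp [this]

theorem cpow_natCast {f : PowerSeries K} (hf : PowerSeries.constantCoeff f = 1) (d : ℕ) :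
    cpow f d = f ^ d := by
  have hs : PowerSeries.HasSubst (f - 1) :=
    PowerSeries.HasSubst.of_constantCoeff_zero' (by simp [hf])
  rw [cpow, PowerSeries.binomialSeries_nat, PowerSeries.subst_pow hs, PowerSeries.subst_add hs,
    PowerSeries.subst_X hs]
  have h1 : PowerSeries.subst (f - 1) (1 : PowerSeries K) = (1 : PowerSeries K) := by
    rw [← PowerSeries.coe_substAlgHom hs, map_one]
  erw [h1]
  rw [add_sub_cancel]

theorem exists_polynomial_coeff_cpow_mul {f : PowerSeries K}
    (hf : PowerSeries.constantCoeff f = 1) (G : PowerSeries K) (l : Polynomial K) (c : K) (n : ℕ) :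
    ∃ Q : Polynomial K,
      ∀ a, c * PowerSeries.coeff n (cpow f (l.eval a) * G) = Q.eval a := by
  choose P hP using exists_polynomial_coeff_cpow hf
  refine ⟨Polynomial.C c * ∑ ij ∈ Finset.HasAntidiagonal.antidiagonal n,
    (P ij.1).comp l * Polynomial.C (PowerSeries.coeff ij.2 G), fun a => ?_⟩
  rw [PowerSeries.coeff_mul, Polynomial.eval_mul, Polynomial.eval_finsetSum, Polynomial.eval_C]
  simp only [Polynomial.eval_mul, Polynomial.eval_C, Polynomial.eval_comp, hP]

/-- Two polynomials agreeing at all positive multiples of a positive integer are equal. -/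
theorem polynomial_eq_of_eval_multiples {P Q : Polynomial K} {c : ℕ} (hc : 0 < c)
    (h : ∀ M : ℕ, 0 < M → P.eval ((c * M : ℕ) : K) = Q.eval ((c * M : ℕ) : K)) : P = Q := by
  apply Polynomial.eq_of_infinite_eval_eq
  refine (Set.infinite_range_of_injective
    (f := fun M : ℕ => ((c * (M + 1) : ℕ) : K)) fun a b hab => ?_).mono ?_
  · have := Nat.eq_of_mul_eq_mul_left hc (Nat.cast_injective hab)
    omega
  · rintro _ ⟨M, rfl⟩
    exact h (M + 1) M.succ_pos

/-- To evaluate the coboundary polynomial at the generic `X`, it is enough to count points of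
`(ℤ/2M)ⁿ`. -/
theorem charSum_eq_of_count {n : ℕ} (A : Finset (Fin n → ℤ)) (Q : Polynomial K)
    (h : ∀ (M : ℕ) [NeZero M], (∑ p : Fin n → ZMod (2 * M),
      ∏ a ∈ A, if ∑ i, a i • p i = 0 then vY else 1) = Q.eval ((2 * M : ℕ) : K)) :
    charSum A = Q := by
  -- Multiples of this number are even and divisible by every multiplicity `m(B)`, as the point
  -- count requires.
  have hc : 0 < 2 * ∏ B ∈ A.powerset, multiplicity B :=
    Nat.mul_pos two_pos (Finset.prod_pos fun B _ => multiplicity_pos B)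
  refine polynomial_eq_of_eval_multiples hc fun M hM => ?_
  have hM' : (∏ B ∈ A.powerset, multiplicity B) * M ≠ 0 :=
    Nat.mul_ne_zero (Finset.prod_pos fun B _ => multiplicity_pos B).ne' hM.ne'
  have : NeZero ((∏ B ∈ A.powerset, multiplicity B) * M) := ⟨hM'⟩
  rw [mul_assoc, ← h, eval_charSum_natCast]
  intro B hB
  exact ((Finset.dvd_prod_of_mem _ (Finset.mem_powerset.2 hB)).mul_right M).mul_left 2

/-! ### Evaluating roots at points, and products over the root systems. -/

section Pairing

variable {n N : ℕ} (p : Fin n → ZMod N)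

theorem sum_e_smul (i : Fin n) : ∑ k, (e i : Fin n → ℤ) k • p k = p i := by
  rw [Finset.sum_eq_single i]
  · simp [e]
  · intro k _ hk
    simp [e, hk]
  · simp

theorem sum_sub_smul (a b : Fin n → ℤ) :
    ∑ k, (a - b) k • p k = ∑ k, a k • p k - ∑ k, b k • p k := by
  simp only [Pi.sub_apply, sub_smul, Finset.sum_sub_distrib]

theorem sum_add_smul (a b : Fin n → ℤ) :
    ∑ k, (a + b) k • p k = ∑ k, a k • p k + ∑ k, b k • p k := by
  simp only [Pi.add_apply, add_smul, Finset.sum_add_distrib]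

end Pairing

theorem e_apply {n : ℕ} (i k : Fin n) : (e i : Fin n → ℤ) k = if k = i then 1 else 0 := by
  rw [e, Pi.single_apply]

theorem e_injective (n : ℕ) : Function.Injective (e : Fin n → Fin n → ℤ) := fun i j h => by
  have := congrFun h i
  simp only [e_apply] at this
  grind

theorem injOn_e_sub_e (n : ℕ) :
    Set.InjOn (fun p : Fin n × Fin n => (e p.1 - e p.2 : Fin n → ℤ)) (pairs n) := by
  rintro ⟨i, j⟩ h ⟨i', j'⟩ h' heq
  have h1 : i < j := by simpa [pairs] using h
  have h2 : i' < j' := by simpa [pairs] using h'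
  have hi := congrFun heq i
  have hj := congrFun heq j
  simp only [Pi.sub_apply, e_apply] at hi hj
  grind

theorem injOn_e_add_e (n : ℕ) :
    Set.InjOn (fun p : Fin n × Fin n => (e p.1 + e p.2 : Fin n → ℤ)) (pairs n) := by
  rintro ⟨i, j⟩ h ⟨i', j'⟩ h' heq
  have h1 : i < j := by simpa [pairs] using h
  have h2 : i' < j' := by simpa [pairs] using h'
  have hi := congrFun heq i
  have hj := congrFun heq j
  simp only [Pi.add_apply, e_apply] at hi hj
  grind

theorem prod_rootsA {n : ℕ} (φ : (Fin n → ℤ) → K) :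
    ∏ a ∈ rootsA n, φ a = ∏ p ∈ pairs n, φ (e p.1 - e p.2) :=
  Finset.prod_image (injOn_e_sub_e n)

theorem prod_rootsD {n : ℕ} (φ : (Fin n → ℤ) → K) :
    ∏ a ∈ rootsD n, φ a = ∏ p ∈ pairs n, φ (e p.1 - e p.2) * φ (e p.1 + e p.2) := by
  rw [rootsD, Finset.prod_union, Finset.prod_image (injOn_e_sub_e n),
    Finset.prod_image (injOn_e_add_e n), Finset.prod_mul_distrib]
  rw [Finset.disjoint_left]
  intro a h h'
  obtain ⟨⟨i, j⟩, h1, rfl⟩ := Finset.mem_image.1 h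
  obtain ⟨⟨i', j'⟩, h2, heq⟩ := Finset.mem_image.1 h'
  have hij : i < j := by simpa [pairs] using h1
  have hj := congrFun heq j
  simp only [Pi.add_apply, Pi.sub_apply, e_apply] at hj
  grind

theorem prod_rootsB {n : ℕ} (φ : (Fin n → ℤ) → K) :
    ∏ a ∈ rootsB n, φ a
      = (∏ i, φ (e i)) * ∏ p ∈ pairs n, φ (e p.1 - e p.2) * φ (e p.1 + e p.2) := by
  have h : rootsB n = rootsD n ∪ Finset.univ.image fun i => e i := rfl
  rw [h, Finset.prod_union, prod_rootsD, Finset.prod_image (e_injective n).injOn, mul_comm]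
  rw [Finset.disjoint_left]
  intro a h h'
  obtain ⟨k, -, rfl⟩ := Finset.mem_image.1 h'
  rcases Finset.mem_union.1 h with h | h
  all_goals
    obtain ⟨⟨i, j⟩, h1, heq⟩ := Finset.mem_image.1 h
    have hij : i < j := by simpa [pairs] using h1
    have hi := congrFun heq i
    have hj := congrFun heq j
    simp only [Pi.add_apply, Pi.sub_apply, e_apply] at hi hj
    grind

theorem prod_rootsC {n : ℕ} (φ : (Fin n → ℤ) → K) :
    ∏ a ∈ rootsC n, φ a
      = (∏ i, φ (2 • e i)) * ∏ p ∈ pairs n, φ (e p.1 - e p.2) * φ (e p.1 + e p.2) := by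
  have h : rootsC n = rootsD n ∪ Finset.univ.image fun i => 2 • e i := rfl
  have hinj : Function.Injective fun i : Fin n => (2 • e i : Fin n → ℤ) :=
    (nsmul_right_injective two_ne_zero).comp (e_injective n)
  rw [h, Finset.prod_union, prod_rootsD, Finset.prod_image hinj.injOn, mul_comm]
  rw [Finset.disjoint_left]
  intro a h h'
  obtain ⟨k, -, rfl⟩ := Finset.mem_image.1 h'
  rcases Finset.mem_union.1 h with h | h
  all_goals
    obtain ⟨⟨i, j⟩, h1, heq⟩ := Finset.mem_image.1 h
    have hij : i < j := by simpa [pairs] using h1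
    have hi := congrFun heq i
    have hj := congrFun heq j
    simp only [Pi.add_apply, Pi.sub_apply, Pi.smul_apply, e_apply, nsmul_eq_mul] at hi hj
    push_cast at hi hj
    grind

/-! ### Ranks -/

theorem basisFun_eq_latticeIncl_e {n : ℕ} (i : Fin n) :
    Pi.basisFun ℚ (Fin n) i = latticeIncl n (e i) := by
  funext k
  simp [latticeIncl, e_apply, Pi.single_apply]

theorem rank_eq_of_e_mem {n : ℕ} {A : Finset (Fin n → ℤ)}
    (h : ∀ i, latticeIncl n (e i) ∈ linSpan A) : rank A = n := by
  have ht : linSpan A = ⊤ := by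
    rw [eq_top_iff, ← (Pi.basisFun ℚ (Fin n)).span_eq, Submodule.span_le]
    rintro _ ⟨i, rfl⟩
    rw [basisFun_eq_latticeIncl_e]
    exact h i
  rw [rank, ht, finrank_top, Module.finrank_fin_fun]

theorem latticeIncl_mem {n : ℕ} {A : Finset (Fin n → ℤ)} {a : Fin n → ℤ} (h : a ∈ A) :
    latticeIncl n a ∈ linSpan A :=
  Submodule.subset_span ⟨a, h, rfl⟩

theorem rank_rootsB (n : ℕ) : rank (rootsB n) = n :=
  rank_eq_of_e_mem fun i => latticeIncl_mem
    (Finset.mem_union_right _ (Finset.mem_image_of_mem _ (Finset.mem_univ i)))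

theorem mem_of_two_nsmul_mem {n : ℕ} {S : Submodule ℚ (Fin n → ℚ)} {x : Fin n → ℚ}
    (h : 2 • x ∈ S) : x ∈ S := by
  have h1 := S.smul_mem (2⁻¹ : ℚ) h
  rwa [← Nat.cast_smul_eq_nsmul ℚ, smul_smul, Nat.cast_ofNat, inv_mul_cancel₀ two_ne_zero,
    one_smul] at h1

theorem rank_rootsC (n : ℕ) : rank (rootsC n) = n :=
  rank_eq_of_e_mem fun i => mem_of_two_nsmul_mem <| by
    rw [← map_nsmul]
    exact latticeIncl_mem
      (Finset.mem_union_right _ (Finset.mem_image_of_mem _ (Finset.mem_univ i)))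

theorem latticeIncl_sub_mem_of_pairs {n : ℕ} {A : Finset (Fin n → ℤ)}
    (hA : ∀ p ∈ pairs n, e p.1 - e p.2 ∈ A) (i j : Fin n) :
    latticeIncl n (e i - e j) ∈ linSpan A := by
  rcases lt_trichotomy i j with h | rfl | h
  · exact latticeIncl_mem (hA (i, j) (by simpa [pairs] using h))
  · simp
  · rw [← neg_sub, map_neg]
    exact neg_mem (latticeIncl_mem (hA (j, i) (by simpa [pairs] using h)))

/-- For `j ≠ i`, `2e_i = (e_i - e_j) + (e_i + e_j)`; such a `j` is missing only when `n = 1`. -/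
theorem rank_rootsD {n : ℕ} (hn : n ≠ 1) : rank (rootsD n) = n := by
  refine rank_eq_of_e_mem fun i => mem_of_two_nsmul_mem ?_
  have : Nontrivial (Fin n) := Fin.nontrivial_iff_two_le.2 (by have := i.pos; omega)
  obtain ⟨j, hj⟩ := exists_ne i
  have h1 : latticeIncl n (e i - e j) ∈ linSpan (rootsD n) :=
    latticeIncl_sub_mem_of_pairs (fun p hp => Finset.mem_union_left _
      (Finset.mem_image_of_mem (fun p : Fin n × Fin n => (e p.1 - e p.2 : Fin n → ℤ)) hp)) i j
  have hadd : ∀ p ∈ pairs n, e p.1 + e p.2 ∈ rootsD n := fun p hp => Finset.mem_union_right _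
      (Finset.mem_image_of_mem (fun p : Fin n × Fin n => (e p.1 + e p.2 : Fin n → ℤ)) hp)
  have h2 : latticeIncl n (e i + e j) ∈ linSpan (rootsD n) := by
    rcases lt_or_gt_of_ne hj with h | h
    · rw [add_comm]
      exact latticeIncl_mem (hadd (j, i) (by simpa [pairs] using h))
    · exact latticeIncl_mem (hadd (i, j) (by simpa [pairs] using h))
  have h3 := add_mem h1 h2
  rw [← map_add] at h3
  rw [← map_nsmul]
  convert h3 using 2
  rw [two_nsmul]; abel

theorem rank_rootsD_one : rank (rootsD 1) = 0 := by
  have h : rootsD 1 = ∅ := by decide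
  rw [h, rank, linSpan]
  simp

/-- The coordinate sum kills every root, so the rank is at most `n`; adjoining `e 0` spans
everything, so it is at least `n`. -/
theorem rank_rootsA (n : ℕ) : rank (rootsA (n + 1)) = n := by
  apply le_antisymm
  · have hle : linSpan (rootsA (n + 1)) < ⊤ := by
      have hk : linSpan (rootsA (n + 1))
          ≤ LinearMap.ker (∑ i, LinearMap.proj i : (Fin (n + 1) → ℚ) →ₗ[ℚ] ℚ) := by
        rw [linSpan, Submodule.span_le]
        rintro _ ⟨a, ha, rfl⟩
        obtain ⟨p, -, rfl⟩ := Finset.mem_image.1 ha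
        simp [latticeIncl, e_apply]
      refine lt_of_le_of_ne le_top fun h => ?_
      rw [h, top_le_iff] at hk
      have : (Pi.single 0 1 : Fin (n + 1) → ℚ)
          ∈ LinearMap.ker (∑ i, LinearMap.proj i : (Fin (n + 1) → ℚ) →ₗ[ℚ] ℚ) := by
        rw [hk]; trivial
      simp at this
    have := Submodule.finrank_lt hle.ne
    rw [Module.finrank_fin_fun] at this
    exact Nat.lt_succ_iff.1 this
  · have ht : linSpan (rootsA (n + 1)) ⊔ Submodule.span ℚ {latticeIncl (n + 1) (e 0)} = ⊤ := by
      rw [eq_top_iff, ← (Pi.basisFun ℚ (Fin (n + 1))).span_eq, Submodule.span_le]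
      rintro _ ⟨i, rfl⟩
      have h1 : latticeIncl (n + 1) (e i - e 0) ∈ linSpan (rootsA (n + 1)) :=
        latticeIncl_sub_mem_of_pairs (fun p hp => Finset.mem_image_of_mem _ hp) i 0
      have h2 := Submodule.add_mem_sup h1 (Submodule.mem_span_singleton_self
        (R := ℚ) (latticeIncl (n + 1) (e 0)))
      rw [← map_add, sub_add_cancel] at h2
      rw [basisFun_eq_latticeIncl_e]
      exact h2
    have h1 := Submodule.finrank_add_le_finrank_add_finrank (linSpan (rootsA (n + 1)))
      (Submodule.span ℚ {latticeIncl (n + 1) (e 0)})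
    rw [ht, finrank_top, Module.finrank_fin_fun] at h1
    have h2 := finrank_span_le_card (R := ℚ) {latticeIncl (n + 1) (e 0)}
    simp only [Set.toFinset_singleton, Finset.card_singleton] at h2
    rw [rank]
    omega

/-! ### Classes of `ℤ/2M` up to sign -/

/-- The class of `x` up to sign, as an element of `{0, …, M}`. -/
def signClass (M : ℕ) [NeZero M] (x : ZMod (2 * M)) : Fin (M + 1) :=
  ⟨x.valMinAbs.natAbs, by have := ZMod.natAbs_valMinAbs_le x; omega⟩

theorem neg_half {M : ℕ} : -(M : ZMod (2 * M)) = M := by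
  rw [neg_eq_iff_add_eq_zero, ← Nat.cast_add, ← two_mul, ZMod.natCast_self]

section SignClass

variable {M : ℕ} [NeZero M]

theorem signClass_eq_iff {x y : ZMod (2 * M)} : signClass M x = signClass M y ↔ x = y ∨ x = -y := by
  rw [← ZMod.natAbs_valMinAbs_eq_natAbs_valMinAbs, signClass, signClass, Fin.mk.injEq]

theorem signClass_natCast (t : Fin (M + 1)) : signClass M ((t : ℕ) : ZMod (2 * M)) = t := by
  apply Fin.ext
  have h : ((t : ℕ) : ZMod (2 * M)).valMinAbs = (t : ℕ) := by
    rw [ZMod.valMinAbs_spec]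
    have := t.is_lt
    have := NeZero.pos M
    refine ⟨by simp, ?_, ?_⟩ <;> push_cast <;> omega
  change Int.natAbs _ = _
  rw [h, Int.natAbs_natCast]

theorem signClass_eq_zero_iff {x : ZMod (2 * M)} : signClass M x = 0 ↔ x = 0 := by
  have h := signClass_natCast (M := M) 0
  rw [Fin.val_zero, Nat.cast_zero] at h
  rw [← h, signClass_eq_iff, neg_zero, or_self]

theorem signClass_eq_last_iff {x : ZMod (2 * M)} :
    signClass M x = Fin.last M ↔ x = (M : ZMod (2 * M)) := by
  have h := signClass_natCast (M := M) (Fin.last M)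
  rw [Fin.val_last] at h
  rw [← h, signClass_eq_iff, neg_half, or_self]

theorem eq_neg_self_iff_half {x : ZMod (2 * M)} : x = -x ↔ x = 0 ∨ x = (M : ZMod (2 * M)) := by
  constructor
  · intro h
    rcases (ZMod.neg_eq_self_iff x).1 h.symm with h | h
    · exact Or.inl h
    · right
      rw [← ZMod.natCast_zmod_val x, Nat.eq_of_mul_eq_mul_left two_pos h]
  · rintro (rfl | rfl)
    · simp
    · exact neg_half.symm

theorem card_signClass_fibre (t : Fin (M + 1)) :
    (Finset.univ.filter fun x => signClass M x = t).card
      = if t = 0 ∨ t = Fin.last M then 1 else 2 := by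
  obtain ⟨y, rfl⟩ : ∃ y, signClass M y = t := ⟨_, signClass_natCast t⟩
  have h : (Finset.univ.filter fun x => signClass M x = signClass M y) = {y, -y} := by
    ext x
    simp [signClass_eq_iff]
  simp only [h, signClass_eq_zero_iff, signClass_eq_last_iff, ← eq_neg_self_iff_half]
  split_ifs with hy
  · rw [← hy]; simp
  · exact Finset.card_pair hy

end SignClass

/-! ### Weighted point counts for each type. -/

theorem sum_comp_fibre {S T : Type*} [Fintype S] [Fintype T] [DecidableEq T]
    (c : S → T) {n : ℕ} (G : (Fin n → T) → K) :
    ∑ p : Fin n → S, G (c ∘ p)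
      = ∑ q, (∏ i, ((Finset.univ.filter fun x => c x = q i).card : K)) * G q := by
  rw [← Finset.sum_fiberwise' _ (fun p : Fin n → S => c ∘ p)]
  refine Finset.sum_congr rfl fun q _ => ?_
  rw [Finset.sum_const, nsmul_eq_mul, ← Nat.cast_prod, ← Fintype.card_piFinset]
  congr 3
  ext p
  simp [Fintype.mem_piFinset, funext_iff]

/-- The number of points, weighted by the roots of types `B`, `C` and `D` vanishing there. -/
theorem sum_signed_weights {M : ℕ} [NeZero M] (α β : K) (n : ℕ) :
    ∑ p : Fin n → ZMod (2 * M),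
      (∏ i, if p i = 0 then α else if p i = (M : ZMod (2 * M)) then β else 1) *
      ∏ r ∈ pairs n, (if p r.1 - p r.2 = 0 then vY else 1) * (if p r.1 + p r.2 = 0 then vY else 1)
    = (n.factorial : K) * PowerSeries.coeff n (deformedExp 2 vY ^ (M - 1) *
        (deformedExp α (vY ^ 2) * deformedExp β (vY ^ 2))) := by
  -- Data per class: `g` weighs one coordinate, `v` a pair of coordinates in the class, and `s` is
  -- the class size.
  let g : Fin (M + 1) → K := fun t => if t = 0 then α else if t = Fin.last M then β else 1
  let v : Fin (M + 1) → K := fun t => if t = 0 ∨ t = Fin.last M then vY ^ 2 else vY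
  let s : Fin (M + 1) → K := fun t => ((if t = 0 ∨ t = Fin.last M then 1 else 2 : ℕ) : K)
  let G : (Fin n → Fin (M + 1)) → K := fun q => (∏ i, g (q i)) *
    ∏ r ∈ pairs n, if q r.1 = q r.2 then v (q r.1) else 1
  have h1 : ∀ p : Fin n → ZMod (2 * M),
      (∏ i, if p i = 0 then α else if p i = (M : ZMod (2 * M)) then β else 1) *
      (∏ r ∈ pairs n, (if p r.1 - p r.2 = 0 then vY else 1) *
        (if p r.1 + p r.2 = 0 then vY else 1))
      = G (signClass M ∘ p) := by
    intro p
    simp only [G, Function.comp_apply, g, v, signClass_eq_zero_iff, signClass_eq_last_iff,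
      signClass_eq_iff, ← eq_neg_self_iff_half, sub_eq_zero, add_eq_zero_iff_eq_neg]
    congr 1
    refine Finset.prod_congr rfl fun r _ => ?_
    by_cases ha : p r.1 = p r.2
    · simp only [← ha, if_true, true_or]
      split_ifs <;> ring
    · by_cases hb : p r.1 = -p r.2
      · have hc : p r.1 ≠ -p r.1 := fun h => ha (neg_injective (h.symm.trans hb))
        rw [if_neg ha, if_pos hb, if_pos (Or.inr hb), if_neg hc, one_mul]
      · simp [ha, hb]
  refine ((Finset.sum_congr rfl fun p _ => h1 p).trans (sum_comp_fibre (signClass M) G)).trans ?_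
  simp_rw [G, card_signClass_fibre, ← mul_assoc, ← Finset.prod_mul_distrib]
  have h2 := sum_weights (fun t => s t * g t) v n
  rw [div_eq_iff (Nat.cast_ne_zero.2 (Nat.factorial_ne_zero n)), mul_comm] at h2
  refine h2.trans ?_
  congr 2
  -- With `M = m + 1` the classes are `0`, `M` and `m = M - 1` middle ones, all with the same
  -- factor.
  obtain ⟨m, rfl⟩ := Nat.exists_eq_succ_of_ne_zero (NeZero.ne M)
  have hmid : ∀ i : Fin m, deformedExp (s i.castSucc.succ * g i.castSucc.succ) (v i.castSucc.succ)
      = deformedExp 2 vY := by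
    intro i
    have h0 : i.castSucc.succ ≠ 0 := Fin.succ_ne_zero _
    have hl : i.castSucc.succ ≠ Fin.last (m + 1) := by
      rw [← Fin.succ_last, Ne, Fin.succ_inj]; exact (Fin.castSucc_lt_last i).ne
    simp [s, g, v, h0, hl]
  rw [Fin.prod_univ_succ, Fin.prod_univ_castSucc]
  simp_rw [hmid]
  have hl0 : Fin.last (m + 1) ≠ 0 := (Fin.last_pos).ne'
  simp [s, g, v, hl0]
  ring

/-- The generating function of a configuration of type `B`, `C` or `D`. -/
theorem charSum_eval_of_signed {n : ℕ} {A : Finset (Fin n → ℤ)} {α β : K}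
    (h : ∀ (M : ℕ) [NeZero M] (p : Fin n → ZMod (2 * M)),
      (∏ a ∈ A, if ∑ i, a i • p i = 0 then vY else 1) =
      (∏ i, if p i = 0 then α else if p i = (M : ZMod (2 * M)) then β else 1) *
      ∏ r ∈ pairs n, (if p r.1 - p r.2 = 0 then vY else 1) *
        (if p r.1 + p r.2 = 0 then vY else 1)) :
    vX ^ (n - rank A) * coboundary A / (n.factorial : K) =
      PowerSeries.coeff n (cpow (deformedExp 2 vY) (vX / 2 - 1) *
        (deformedExp α (vY ^ 2) * deformedExp β (vY ^ 2))) := by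
  obtain ⟨Q, hQ⟩ := exists_polynomial_coeff_cpow_mul (constantCoeff_deformedExp 2 vY)
    (deformedExp α (vY ^ 2) * deformedExp β (vY ^ 2))
    (Polynomial.C 2⁻¹ * Polynomial.X - 1) (n.factorial : K) n
  have key : charSum A = Q := by
    refine charSum_eq_of_count A Q fun M _ => ?_
    -- At `X = 2M` the exponent `X/2 - 1` is the natural number `M - 1`, so `cpow` is an ordinary
    -- power.
    have hl : (Polynomial.C 2⁻¹ * Polynomial.X - 1 : Polynomial K).eval ((2 * M : ℕ) : K)
        = ((M - 1 : ℕ) : K) := by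
      rw [Nat.cast_sub (NeZero.pos M)]
      simp
    simp_rw [h M]
    rw [sum_signed_weights, ← hQ, hl, cpow_natCast (constantCoeff_deformedExp 2 vY)]
  have hl : (Polynomial.C 2⁻¹ * Polynomial.X - 1 : Polynomial K).eval vX = vX / 2 - 1 := by
    simp; ring
  rw [← eval_charSum_vX, key, ← hQ, hl,
    mul_div_cancel_left₀ _ (Nat.cast_ne_zero.2 (Nat.factorial_ne_zero n))]

theorem coeff_rootsA (n : ℕ) :
    vX ^ (n - rank (rootsA n)) * coboundary (rootsA n) / (n.factorial : K) =
      PowerSeries.coeff n (cpow (deformedExp 1 vY) vX) := by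
  obtain ⟨Q, hQ⟩ := exists_polynomial_coeff_cpow_mul (constantCoeff_deformedExp 1 vY) 1
    Polynomial.X (n.factorial : K) n
  simp only [Polynomial.eval_X, mul_one] at hQ
  have key : charSum (rootsA n) = Q := by
    refine charSum_eq_of_count _ Q fun M _ => ?_
    have h := sum_weights (fun _ : ZMod (2 * M) => 1) (fun _ => vY) n
    rw [div_eq_iff (Nat.cast_ne_zero.2 (Nat.factorial_ne_zero n)), mul_comm _ (n.factorial : K), Finset.prod_const (deformedExp 1 vY),
      Finset.card_univ, ZMod.card] at h
    rw [← hQ, cpow_natCast (constantCoeff_deformedExp 1 vY), ← h]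
    simp only [prod_rootsA, sum_sub_smul, sum_e_smul, sub_eq_zero, Finset.prod_const_one, one_mul]
  rw [← eval_charSum_vX, key, ← hQ,
    mul_div_cancel_left₀ _ (Nat.cast_ne_zero.2 (Nat.factorial_ne_zero n))]

theorem multiplicity_empty {n : ℕ} : multiplicity (∅ : Finset (Fin n → ℤ)) = 1 := by
  rw [multiplicity, AddSubgroup.relIndex_eq_one]
  intro x hx
  have h : latticeIncl n x ∈ linSpan (∅ : Finset (Fin n → ℤ)) := hx
  have h0 : latticeIncl n x = latticeIncl n 0 := by simpa [linSpan] using h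
  rw [latticeIncl_injective n h0]
  exact zero_mem _

theorem coboundary_empty {n : ℕ} : coboundary (∅ : Finset (Fin n → ℤ)) = 1 := by
  simp [coboundary_eq_sum, multiplicity_empty]

/-- The rank defect is `1` for every `n ≥ 1`, which accounts for the prefactor `X` in `PsiA`; for `n
= 0` it is `0`. -/
theorem PsiA_eq : PsiA = cpow (deformedExp 1 vY) vX := by
  ext n
  rw [← coeff_rootsA]
  cases n with
  | zero =>
    have h : rootsA 0 = ∅ := by decide
    rw [h, coboundary_empty]
    simp [PsiA]
  | succ n =>
    rw [rank_rootsA, Nat.add_sub_cancel_left, pow_one]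
    simp [PsiA, PowerSeries.coeff_one, mul_div_assoc]

theorem coeff_rootsB (n : ℕ) :
    coboundary (rootsB n) / (n.factorial : K) =
      PowerSeries.coeff n (cpow (deformedExp 2 vY) (vX / 2 - 1) *
        (deformedExp vY (vY ^ 2) * deformedExp 1 (vY ^ 2))) := by
  rw [← charSum_eval_of_signed (A := rootsB n), rank_rootsB, Nat.sub_self, pow_zero, one_mul]
  intro M _ p
  simp only [prod_rootsB, sum_sub_smul, sum_add_smul, sum_e_smul, ite_self]

theorem coeff_rootsC (n : ℕ) :
    coboundary (rootsC n) / (n.factorial : K) =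
      PowerSeries.coeff n (cpow (deformedExp 2 vY) (vX / 2 - 1) *
        (deformedExp vY (vY ^ 2) * deformedExp vY (vY ^ 2))) := by
  rw [← charSum_eval_of_signed (A := rootsC n), rank_rootsC, Nat.sub_self, pow_zero, one_mul]
  intro M _ p
  simp only [prod_rootsC, two_nsmul, sum_sub_smul, sum_add_smul, sum_e_smul,
    add_eq_zero_iff_eq_neg (b := p _), eq_neg_self_iff_half]
  congr 1
  refine Finset.prod_congr rfl fun i _ => ?_
  split_ifs <;> tauto

theorem coeff_rootsD (n : ℕ) :
    vX ^ (n - rank (rootsD n)) * coboundary (rootsD n) / (n.factorial : K) =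
      PowerSeries.coeff n (cpow (deformedExp 2 vY) (vX / 2 - 1) *
        (deformedExp 1 (vY ^ 2) * deformedExp 1 (vY ^ 2))) := by
  rw [← charSum_eval_of_signed (A := rootsD n)]
  intro M _ p
  simp only [prod_rootsD, sum_sub_smul, sum_add_smul, sum_e_smul, ite_self,
    Finset.prod_const_one, one_mul]

end

end ArithTutte

open ArithTutte PowerSeries in
theorem theorem1p8 :
    PsiA = cpow (F vZ vY) vX ∧
    Psi rootsB = cpow (F (2 * vZ) vY) (vX / 2 - 1) * F vZ (vY ^ 2) * F (C vY * vZ) (vY ^ 2) ∧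
    Psi rootsC = cpow (F (2 * vZ) vY) (vX / 2 - 1) * F (C vY * vZ) (vY ^ 2) ^ 2 ∧
    Psi rootsD + C (vX - 1) * vZ = cpow (F (2 * vZ) vY) (vX / 2 - 1) * F vZ (vY ^ 2) ^ 2 := by
  rw [F_vZ, F_vZ, F_two_mul, F_C_mul]
  refine ⟨PsiA_eq, ?_, ?_, ?_⟩
  · ext n
    rw [Psi, coeff_mk, coeff_rootsB, mul_assoc, mul_comm (deformedExp vY _)]
  · ext n
    rw [Psi, coeff_mk, coeff_rootsC, sq (deformedExp _ _)]
  · ext n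
    rw [sq (deformedExp _ _), ← coeff_rootsD, map_add, Psi, coeff_mk, coeff_C_mul, vZ, coeff_X]
    -- Only `D_1` is rank-deficient: its coefficient is `X = 1 + (X - 1)`.
    by_cases hn : n = 1
    · subst hn
      have h : rootsD 1 = ∅ := by decide
      rw [rank_rootsD_one, h, coboundary_empty]
      simp
    · rw [rank_rootsD hn]
      simp [hn]
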